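/- Let $S^2\subset\mathbb R^3$ be the unit sphere with its standard Riemannian metric, and let $$\mathbb C=\coprod_{p\in S^2} L^2([0,1],T_pS^2),$$ a Hilbert vector bundle over $S^2$ (smooth as a submanifold of $\mathbb R^3\times L^2([0,1],\mathbb R^3)$), with fibres $\mathbb C_p=L^2([0,1],T_pS^2)$. Identify $T_{(x,v)}\mathbb C\cong T_xS^2\oplus\mathbb C_x$ so that the velocity of a smooth path $(\beta(s),q(s,\cdot))$ in $\mathbb C$ is $(\beta_s,\nabla_{\beta_s}q)$, where $\beta_s=\dot\beta(s)$ and $\nabla_{\beta_s}$ is covariant differentiation along $\beta$ (for each $t$, the orthogonal projection to $T_{\beta(s)}S^2$ of the $s$-derivative, the derivative being taken in $L^2$). Give $\mathbb C$ the Riemannian metric $$\langle(u_1,w_1),(u_2,w_2)\rangle=u_1\cdot u_2+\int_0^1 w_1(t)\cdot w_2(t)\,dt .$$ Let $(\beta(s),q(s,\cdot))$, $s\in[0,1]$, be a geodesic in $\mathbb C$ for this metric, that is, a smooth path that is a critical point of the energy $\frac12\int_0^1\big(|\dot\beta(s)|^2+\int_0^1|\nabla_{\beta_s}q(s,t)|^2dt\big)ds$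 among smooth variations with fixed end points. Then: 1. the base curve $\beta$ has constant speed: $|\dot\beta(s)|$ is the same for all $s\in[0,1]$; 2. $q$ is covariantly linear along $\beta$: $\nabla_{\beta_s}(\nabla_{\beta_s}q(s,\cdot))=0$ in $L^2([0,1],T_{\beta(s)}S^2)$ for every $s\in[0,1]$. -/

import Mathlib

open MeasureTheory Set
open scoped ContDiff

noncomputable section

namespace SphereBundle

/-- The ambient Euclidean space `ℝ³`. -/
abbrev E3 : Type := EuclideanSpace ℝ (Fin 3)

/-- The unit sphere `S² ⊆ ℝ³`. -/
abbrev S2 : Type := Metric.sphere (0 : E3) 1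

/-- The tangent plane `T_p S² = p^⊥ ⊆ ℝ³`, with the inner product inherited from `ℝ³`
(the standard Riemannian metric of the sphere). -/
abbrev TangentPlane (p : S2) : Submodule ℝ E3 := (Submodule.span ℝ {(p : E3)})ᗮ

/-- Lebesgue measure on `[0,1]`. -/
abbrev unitMeasure : Measure ℝ := volume.restrict (Icc (0 : ℝ) 1)

/-- The fibre `ℂ_p = L²([0,1], T_p S²)`. -/
abbrev Fiber (p : S2) : Type := Lp (TangentPlane p) 2 unitMeasure

/-- The ambient Hilbert space `L²([0,1], ℝ³)`. -/
abbrev AmbientL2 : Type := Lp E3 2 unitMeasure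

/-- The total space `ℂ = ⊔ₚ L²([0,1], T_p S²)`. -/
abbrev BundleC : Type := Σ p : S2, Fiber p

/-- The inclusion `L²([0,1], T_p S²) → L²([0,1], ℝ³)` induced by `T_p S² ⊆ ℝ³`. -/
def fiberIncl (p : S2) : Fiber p →L[ℝ] AmbientL2 :=
  ContinuousLinearMap.compLpL 2 unitMeasure (TangentPlane p).subtypeL

/-- The map `L²([0,1], ℝ³) → L²([0,1], T_p S²)` that applies the orthogonal projection
`ℝ³ → T_p S²` to each value. -/
def fiberProj (p : S2) : AmbientL2 →L[ℝ] Fiber p :=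
  ContinuousLinearMap.compLpL 2 unitMeasure (TangentPlane p).orthogonalProjectionOnto

/-- The tangent space `T_{(x,v)} ℂ = T_x S² ⊕ ℂ_x`. -/
abbrev TangentC (z : BundleC) : Type := TangentPlane z.1 × Fiber z.1

/-- The Riemannian metric of `ℂ`:
`⟨(u₁,w₁),(u₂,w₂)⟩ = u₁ ⬝ u₂ + ∫₀¹ w₁(t) ⬝ w₂(t) dt`. -/
def metricC (z : BundleC) (X Y : TangentC z) : ℝ :=
  inner ℝ X.1 Y.1 + ∫ t, inner ℝ (X.2 t) (Y.2 t) ∂unitMeasure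

/-- The velocity `β'(s) ∈ T_{β(s)} S²`, for `s ∈ [0,1]` (one-sided at the end points).
Where `β` is differentiable, its derivative in `ℝ³` is already tangent to the sphere, so that the
projection changes nothing; it only makes the value an element of the tangent plane. -/
def baseVelocity (β : ℝ → S2) (s : ℝ) : TangentPlane (β s) :=
  (TangentPlane (β s)).orthogonalProjectionOnto
    (derivWithin (fun r => (β r : E3)) (Icc 0 1) s)

/-- The covariant derivative `∇_{β_s} V` along a base curve `β` in `S²` of a field
`V(s,·) ∈ L²([0,1], T_{β(s)} S²)`: the tangential part, for each `t`, of the derivative in `s`. -/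
def covDeriv (β : ℝ → S2) (V : (s : ℝ) → Fiber (β s)) (s : ℝ) : Fiber (β s) :=
  fiberProj (β s) (derivWithin (fun r => fiberIncl (β r) (V r)) (Icc 0 1) s)

/-- The base curve `β` of a path in `ℂ`. -/
abbrev baseCurve (γ : ℝ → BundleC) (s : ℝ) : S2 := (γ s).1

/-- The fibre part `q(s,·)` of a path in `ℂ`. -/
abbrev fiberPart (γ : ℝ → BundleC) (s : ℝ) : Fiber (baseCurve γ s) := (γ s).2

/-- The velocity `(β_s, ∇_{β_s} q) ∈ T_{β(s)} S² ⊕ ℂ_{β(s)}` of a path `(β, q)` in `ℂ`. -/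
def velocity (γ : ℝ → BundleC) (s : ℝ) : TangentC (γ s) :=
  (baseVelocity (baseCurve γ) s, covDeriv (baseCurve γ) (fiberPart γ) s)

/-- The energy `½ ∫₀¹ ⟨γ'(s), γ'(s)⟩ ds` of a path over `[0,1]` in `ℂ`. -/
def energy (γ : ℝ → BundleC) : ℝ :=
  (1 / 2) * ∫ s in (0 : ℝ)..1, metricC (γ s) (velocity γ s) (velocity γ s)

/-- The embedding of `ℂ` as a submanifold of the Hilbert space `ℝ³ × L²([0,1], ℝ³)`, which carries
its smooth structure (but not its metric). -/
def ambient (z : BundleC) : E3 × AmbientL2 := ((z.1 : E3), fiberIncl z.1 z.2)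

/-- A smooth path `[0,1] → ℂ`; the values of `γ` outside `[0,1]` play no role. -/
def IsSmoothPath (γ : ℝ → BundleC) : Prop :=
  ContDiffOn ℝ ∞ (fun s => ambient (γ s)) (Icc 0 1)

/-- A smooth variation `(-δ,δ) × [0,1] → ℂ`, `(ε, s) ↦ Γ ε s`, of the path `γ` with fixed end
points. -/
structure IsVariation (γ : ℝ → BundleC) (δ : ℝ) (Γ : ℝ → ℝ → BundleC) : Prop where
  pos : 0 < δ
  smooth : ContDiffOn ℝ ∞ (fun x : ℝ × ℝ => ambient (Γ x.1 x.2)) (Ioo (-δ) δ ×ˢ Icc 0 1)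
  center : ∀ s ∈ Icc (0 : ℝ) 1, Γ 0 s = γ s
  left : ∀ ε ∈ Ioo (-δ) δ, Γ ε 0 = γ 0
  right : ∀ ε ∈ Ioo (-δ) δ, Γ ε 1 = γ 1

/-- A geodesic `[0,1] → ℂ` of the Riemannian metric `metricC`: a smooth path that is a critical
point of the energy with respect to all smooth variations with fixed end points. -/
structure IsGeodesic (γ : ℝ → BundleC) : Prop where
  smooth : IsSmoothPath γ
  critical : ∀ (δ : ℝ) (Γ : ℝ → ℝ → BundleC), IsVariation γ δ Γ →
    HasDerivAt (fun ε => energy (Γ ε)) 0 0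

end SphereBundle

end

/-!
Two families of variations suffice. Reparametrising a path by `s ↦ s + ε * η s`, with `η` vanishing
at the end points, turns its energy density `e` into `(1 + ε * η') ^ 2 * e (s + ε * η s)`. The
derivative of the integral at `ε = 0` is `∫ (2 * η' * e + η * e') = -∫ η * e'`, so `e` is constant
along a geodesic. Moving `q` inside the fibres by `ε • W` gives `∫ ⟪∇q, ∇W⟫ = 0`, hence `∇∇q = 0`
after an integration by parts. Then `‖∇q‖ ^ 2` is constant because `∇` is compatible with the inner
product, and so is `‖b'‖ ^ 2 = e - ‖∇q‖ ^ 2`. Of the bundle this uses only that its fibres are the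
ranges of a smooth family of orthogonal projections of one fixed inner product space.
-/

section Calculus

open scoped Topology

variable {G : Type*} [NormedAddCommGroup G]

theorem eqOn_zero_of_intervalIntegral_mul_norm_sq_eq_zero {a b : ℝ} (hab : a < b) {w : ℝ → ℝ}
    {f : ℝ → G} (hw : ContinuousOn w (Icc a b)) (hw_pos : ∀ s ∈ Ioo a b, 0 < w s)
    (hf : ContinuousOn f (Icc a b)) (h : ∫ s in a..b, w s * ‖f s‖ ^ 2 = 0) :
    EqOn f 0 (Icc a b) := by
  have hcont : ContinuousOn (fun s => w s * ‖f s‖ ^ 2) (Icc a b) := hw.mul (hf.norm.pow 2)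
  have hnonneg : 0 ≤ᵐ[volume.restrict (Ioo a b)] fun s => w s * ‖f s‖ ^ 2 :=
    ae_restrict_of_forall_mem measurableSet_Ioo fun s hs => by
      have := hw_pos s hs
      positivity
  rw [intervalIntegral.integral_of_le hab.le, integral_Ioc_eq_integral_Ioo,
    setIntegral_eq_zero_iff_of_nonneg_ae hnonneg
      (hcont.integrableOn_Icc.mono_set Ioo_subset_Icc_self)] at h
  have hzero : f =ᵐ[volume.restrict (Ioo a b)] 0 := by
    filter_upwards [h, ae_restrict_mem measurableSet_Ioo] with s hs hsab
    simpa [(hw_pos s hsab).ne'] using hs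
  exact Measure.eqOn_Icc_of_ae_eq volume hab.ne
    (by rwa [← restrict_Ioo_eq_restrict_Icc]) hf continuousOn_const

variable [NormedSpace ℝ G] {a b : ℝ}

theorem hasDerivAt_intervalIntegral_of_continuousOn {𝕜 : Type*} [RCLike 𝕜] [NormedSpace 𝕜 G]
    {x₀ : 𝕜} {U : Set 𝕜} {F F' : 𝕜 → ℝ → G} (hU : U ∈ 𝓝 x₀)
    (hF : ∀ x ∈ U, ContinuousOn (F x) (uIcc a b))
    (hF' : ContinuousOn (Function.uncurry F') (U ×ˢ uIcc a b))
    (hderiv : ∀ x ∈ U, ∀ s ∈ uIcc a b, HasDerivAt (F · s) (F' x s) x) :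
    HasDerivAt (fun x => ∫ s in a..b, F x s) (∫ s in a..b, F' x₀ s) x₀ := by
  obtain ⟨r, hr, hrU⟩ := Metric.nhds_basis_closedBall.mem_iff.1 hU
  obtain ⟨M, hM⟩ := ((isCompact_closedBall x₀ r).prod (isCompact_uIcc (a := a) (b := b))
    |>.bddAbove_image (hF'.mono (prod_mono_left hrU)).norm)
  have measurable {f : ℝ → G} (hf : ContinuousOn f (uIcc a b)) :
      AEStronglyMeasurable f (volume.restrict (uIoc a b)) :=
    (hf.mono uIoc_subset_uIcc).aestronglyMeasurable measurableSet_uIoc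
  have hF'x₀ : ContinuousOn (F' x₀) (uIcc a b) :=
    hF'.comp (f := fun s => (x₀, s)) (by fun_prop) fun s hs => ⟨mem_of_mem_nhds hU, hs⟩
  refine (intervalIntegral.hasDerivAt_integral_of_dominated_loc_of_deriv_le
    (Metric.closedBall_mem_nhds x₀ hr) ?_ (hF x₀ (mem_of_mem_nhds hU)).intervalIntegrable
    (measurable hF'x₀) (.of_forall fun s hs x hx => ?_)
    (intervalIntegrable_const (c := M))
    (.of_forall fun s hs x hx => hderiv x (hrU hx) s (uIoc_subset_uIcc hs))).2
  · filter_upwards [hU] with x hx using measurable (hF x hx)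
  · exact hM (mem_image_of_mem (fun z : 𝕜 × ℝ => ‖F' z.1 z.2‖)
      (mk_mem_prod hx (uIoc_subset_uIcc hs)))

theorem contDiffOn_derivWithin_Icc (hab : a < b) {f : ℝ → G} (hf : ContDiffOn ℝ ∞ f (Icc a b)) :
    ContDiffOn ℝ ∞ (derivWithin f (Icc a b)) (Icc a b) :=
  hf.derivWithin (uniqueDiffOn_Icc hab) (by simp)

theorem exists_mapsTo_reparam {k : ℝ → ℝ} (hk : ContinuousOn k (Icc 0 1)) :
    ∃ δ > 0, ∀ ε ∈ Ioo (-δ) δ,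
      MapsTo (fun s => s + ε * (s * (1 - s) * k s)) (Icc 0 1) (Icc 0 1) := by
  obtain ⟨M, hM⟩ := isCompact_Icc.bddAbove_image hk.norm
  have hM' (s : ℝ) (hs : s ∈ Icc (0 : ℝ) 1) : |k s| ≤ M := hM (mem_image_of_mem _ hs)
  have hM₀ : 0 ≤ M := (abs_nonneg _).trans (hM' 0 (by simp))
  refine ⟨1 / (M + 1), by positivity, fun ε hε s hs => ?_⟩
  have hεk : |ε * k s| ≤ 1 := by
    rw [abs_mul]
    calc |ε| * |k s| ≤ 1 / (M + 1) * (M + 1) := by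
          gcongr
          · exact (abs_lt.2 hε).le
          · linarith [hM' s hs]
      _ = 1 := by field_simp
  obtain ⟨hlower, hupper⟩ := abs_le.1 hεk
  obtain ⟨hs₀, hs₁⟩ := hs
  have := mul_nonneg hs₀ (sub_nonneg.2 hs₁)
  constructor <;> nlinarith

variable {e e' : ℝ → G} {η η' : ℝ → ℝ}

theorem hasDerivAt_comp_add_mul {U : Set ℝ} (hU : IsOpen U)
    (hmaps : ∀ ε ∈ U, MapsTo (fun s => s + ε * η s) (Icc a b) (Icc a b))
    (he : ∀ s ∈ Icc a b, HasDerivWithinAt e (e' s) (Icc a b) s) {ε s : ℝ} (hε : ε ∈ U)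
    (hs : s ∈ Icc a b) :
    HasDerivAt (fun ε => e (s + ε * η s)) (η s • e' (s + ε * η s)) ε := by
  have hinner : HasDerivWithinAt (fun ε => s + ε * η s) (η s) U ε := by
    simpa using (((hasDerivAt_id ε).mul_const (η s)).const_add s).hasDerivWithinAt
  exact ((he _ (hmaps ε hε hs)).scomp ε hinner fun ε hε => hmaps ε hε hs).hasDerivAt
    (hU.mem_nhds hε)

theorem hasDerivAt_intervalIntegral_sq_smul_comp_add_mul (hab : a ≤ b) {U : Set ℝ}
    (hU : IsOpen U) (h₀ : 0 ∈ U)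
    (hmaps : ∀ ε ∈ U, MapsTo (fun s => s + ε * η s) (Icc a b) (Icc a b))
    (he : ∀ s ∈ Icc a b, HasDerivWithinAt e (e' s) (Icc a b) s)
    (he' : ContinuousOn e' (Icc a b)) (hη : ContinuousOn η (Icc a b))
    (hη' : ContinuousOn η' (Icc a b)) :
    HasDerivAt (fun ε => ∫ s in a..b, (1 + ε * η' s) ^ 2 • e (s + ε * η s))
      (∫ s in a..b, ((2 : ℝ) • η' s • e s + η s • e' s)) 0 := by
  have he_cont : ContinuousOn e (Icc a b) := fun s hs => (he s hs).continuousWithinAt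
  let F' (ε s : ℝ) : G := (2 * (1 + ε * η' s) * η' s) • e (s + ε * η s) +
    (1 + ε * η' s) ^ 2 • η s • e' (s + ε * η s)
  convert hasDerivAt_intervalIntegral_of_continuousOn (F' := F') (hU.mem_nhds h₀) ?_ ?_ ?_ using 1
  · simp [F', mul_smul]
  all_goals rw [uIcc_of_le hab]
  · intro ε hε
    exact .smul (by fun_prop) (he_cont.comp (by fun_prop) (hmaps ε hε))
  · have hsnd : MapsTo Prod.snd (U ×ˢ Icc a b) (Icc a b) := fun _ hz => hz.2
    have hη_snd := hη.comp continuousOn_snd hsnd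
    have hη'_snd := hη'.comp continuousOn_snd hsnd
    have hshift : MapsTo (fun z : ℝ × ℝ => z.2 + z.1 * η z.2) (U ×ˢ Icc a b) (Icc a b) :=
      fun z hz => hmaps z.1 hz.1 hz.2
    have hshift_cont := continuousOn_snd.add (continuousOn_fst.mul hη_snd)
    have he_shift := he_cont.comp hshift_cont hshift
    have he'_shift := he'.comp hshift_cont hshift
    have hspeed := (continuousOn_const (c := (1 : ℝ))).add (continuousOn_fst.mul hη'_snd)
    exact (((continuousOn_const.mul hspeed).mul hη'_snd).smul he_shift).add
      ((hspeed.pow 2).smul (hη_snd.smul he'_shift))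
  · intro ε hε s hs
    have hsq : HasDerivAt (fun ε => (1 + ε * η' s) ^ 2) (2 * (1 + ε * η' s) * η' s) ε := by
      simpa using (((hasDerivAt_id ε).mul_const (η' s)).const_add 1).fun_pow 2
    convert hsq.fun_smul (hasDerivAt_comp_add_mul hU hmaps he hε hs) using 1
    exact add_comm _ _

theorem hasDerivAt_intervalIntegral_reparam [CompleteSpace G] (hab : a ≤ b) {U : Set ℝ}
    (hU : IsOpen U) (h₀ : 0 ∈ U)
    (hmaps : ∀ ε ∈ U, MapsTo (fun s => s + ε * η s) (Icc a b) (Icc a b))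
    (he : ∀ s ∈ Icc a b, HasDerivWithinAt e (e' s) (Icc a b) s)
    (he' : ContinuousOn e' (Icc a b))
    (hη : ∀ s ∈ Icc a b, HasDerivWithinAt η (η' s) (Icc a b) s)
    (hη' : ContinuousOn η' (Icc a b)) (hηa : η a = 0) (hηb : η b = 0) :
    HasDerivAt (fun ε => ∫ s in a..b, (1 + ε * η' s) ^ 2 • e (s + ε * η s))
      (-∫ s in a..b, η s • e' s) 0 := by
  have he_cont : ContinuousOn e (Icc a b) := fun s hs => (he s hs).continuousWithinAt
  have hη_cont : ContinuousOn η (Icc a b) := fun s hs => (hη s hs).continuousWithinAt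
  convert hasDerivAt_intervalIntegral_sq_smul_comp_add_mul hab hU h₀ hmaps he he' hη_cont hη'
    using 1
  rw [← uIcc_of_le hab] at he he' hη hη' he_cont hη_cont
  have hparts : ∫ s in a..b, η s • e' s = -∫ s in a..b, η' s • e s := by
    rw [intervalIntegral.integral_smul_deriv_eq_deriv_smul_of_hasDerivWithinAt hη he
      hη'.intervalIntegrable he'.intervalIntegrable]
    simp [hηa, hηb]
  have hη'e : IntervalIntegrable (fun s => (2 : ℝ) • η' s • e s) volume a b :=
    ((hη'.smul he_cont).const_smul _).intervalIntegrable
  have hηe' : IntervalIntegrable (fun s => η s • e' s) volume a b :=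
    (hη_cont.smul he').intervalIntegrable
  rw [intervalIntegral.integral_add hη'e hηe', intervalIntegral.integral_smul, hparts]
  module

end Calculus

/-- A Hilbert vector bundle over a subset `base` of `E`, given as a subbundle of the trivial bundle
with fibre `H`: the fibre over `p` is the range of the orthogonal projection `proj p`. -/
structure HilbertSubbundle (E H : Type*) [NormedAddCommGroup E] [InnerProductSpace ℝ E]
    [NormedAddCommGroup H] [InnerProductSpace ℝ H] where
  base : Set E
  proj : E → H →L[ℝ] H
  contDiffOn_proj : ContDiffOn ℝ ∞ proj base
  isSymmetricProjection_proj : ∀ p ∈ base, (proj p).toLinearMap.IsSymmetricProjection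

namespace HilbertSubbundle

variable {E H : Type*} [NormedAddCommGroup E] [InnerProductSpace ℝ E] [NormedAddCommGroup H]
  [InnerProductSpace ℝ H] (B : HilbertSubbundle E H)

/-- The total space of the bundle, as a subset of the trivial bundle. -/
def totalSpace : Set (E × H) := {z | z.1 ∈ B.base ∧ B.proj z.1 z.2 = z.2}

/-- The covariant derivative along the base curve `b` of a field `V` of fibre vectors: the
derivative in `H` projected back to the fibre. As in all notions below, paths are parametrised by
`[0,1]` and derivatives are one-sided at the end points. -/
noncomputable def covDeriv (b : ℝ → E) (V : ℝ → H) (s : ℝ) : H :=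
  B.proj (b s) (derivWithin V (Icc 0 1) s)

/-- A smooth path `[0,1] → B.totalSpace`, given by its base curve `b` and its fibre part `V`; in
other words, `V` is a smooth section of the bundle along `b`. -/
structure IsSmoothPath (b : ℝ → E) (V : ℝ → H) : Prop where
  contDiffOn : ContDiffOn ℝ ∞ (fun s => (b s, V s)) (Icc 0 1)
  mem_totalSpace : ∀ s ∈ Icc (0 : ℝ) 1, (b s, V s) ∈ B.totalSpace

/-- The squared speed of the path `(b, q)` for the metric that makes the horizontal and vertical
parts `b'` and `∇q` of the velocity orthogonal. -/
noncomputable def energyDensity (b : ℝ → E) (q : ℝ → H) (s : ℝ) : ℝ :=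
  ‖derivWithin b (Icc 0 1) s‖ ^ 2 + ‖B.covDeriv b q s‖ ^ 2

/-- The energy of the path `(b, q)` over `[0,1]`. -/
noncomputable def energy (b : ℝ → E) (q : ℝ → H) : ℝ :=
  1 / 2 * ∫ s in (0 : ℝ)..1, B.energyDensity b q s

/-- A smooth variation `(ε, s) ↦ (β ε s, Q ε s)`, for `|ε| < δ`, of the path `(b, q)` through paths
in the total space with the same end points. -/
structure IsVariation (b : ℝ → E) (q : ℝ → H) (δ : ℝ) (β : ℝ → ℝ → E) (Q : ℝ → ℝ → H) :
    Prop where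
  pos : 0 < δ
  contDiffOn : ContDiffOn ℝ ∞ (fun x : ℝ × ℝ => (β x.1 x.2, Q x.1 x.2)) (Ioo (-δ) δ ×ˢ Icc 0 1)
  mem_totalSpace : ∀ ε ∈ Ioo (-δ) δ, ∀ s ∈ Icc (0 : ℝ) 1, (β ε s, Q ε s) ∈ B.totalSpace
  center : ∀ s ∈ Icc (0 : ℝ) 1, (β 0 s, Q 0 s) = (b s, q s)
  left : ∀ ε ∈ Ioo (-δ) δ, (β ε 0, Q ε 0) = (b 0, q 0)
  right : ∀ ε ∈ Ioo (-δ) δ, (β ε 1, Q ε 1) = (b 1, q 1)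

/-- A geodesic `[0,1] → B.totalSpace`: a smooth path that is critical for the energy among all
smooth variations with fixed end points. -/
structure IsGeodesic (b : ℝ → E) (q : ℝ → H) : Prop extends B.IsSmoothPath b q where
  critical : ∀ (δ : ℝ) (β : ℝ → ℝ → E) (Q : ℝ → ℝ → H), B.IsVariation b q δ β Q →
    HasDerivAt (fun ε => B.energy (β ε) (Q ε)) 0 0

variable {B} {b : ℝ → E} {q V W : ℝ → H} {η : ℝ → ℝ} {s : ℝ}

theorem proj_proj {p : E} (hp : p ∈ B.base) (v : H) : B.proj p (B.proj p v) = B.proj p v :=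
  DFunLike.congr_fun (B.isSymmetricProjection_proj p hp).isIdempotentElem v

theorem inner_proj_left {p : E} (hp : p ∈ B.base) (v w : H) :
    inner ℝ (B.proj p v) w = inner ℝ v (B.proj p w) :=
  (B.isSymmetricProjection_proj p hp).isSymmetric v w

theorem energy_congr {b' : ℝ → E} {q' : ℝ → H} (hb : EqOn b b' (Icc 0 1))
    (hq : EqOn q q' (Icc 0 1)) : B.energy b q = B.energy b' q' := by
  refine congrArg _ (intervalIntegral.integral_congr fun s hs => ?_)
  rw [uIcc_of_le zero_le_one] at hs
  simp only [energyDensity, covDeriv, hb hs, derivWithin_congr hb (hb hs),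
    derivWithin_congr hq (hq hs)]

namespace IsSmoothPath

theorem base (h : B.IsSmoothPath b V) : ContDiffOn ℝ ∞ b (Icc 0 1) := h.contDiffOn.fst

theorem fiber (h : B.IsSmoothPath b V) : ContDiffOn ℝ ∞ V (Icc 0 1) := h.contDiffOn.snd

theorem hasDerivWithinAt_base (h : B.IsSmoothPath b V) (hs : s ∈ Icc 0 1) :
    HasDerivWithinAt b (derivWithin b (Icc 0 1) s) (Icc 0 1) s :=
  (h.base.differentiableOn (by simp) s hs).hasDerivWithinAt

theorem hasDerivWithinAt_fiber (h : B.IsSmoothPath b V) (hs : s ∈ Icc 0 1) :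
    HasDerivWithinAt V (derivWithin V (Icc 0 1) s) (Icc 0 1) s :=
  (h.fiber.differentiableOn (by simp) s hs).hasDerivWithinAt

theorem mem_base (h : B.IsSmoothPath b V) (hs : s ∈ Icc 0 1) : b s ∈ B.base :=
  (h.mem_totalSpace s hs).1

theorem proj_apply (h : B.IsSmoothPath b V) (hs : s ∈ Icc 0 1) : B.proj (b s) (V s) = V s :=
  (h.mem_totalSpace s hs).2

theorem add (hV : B.IsSmoothPath b V) (hW : B.IsSmoothPath b W) :
    B.IsSmoothPath b fun s => V s + W s where
  contDiffOn := hV.base.prodMk (hV.fiber.add hW.fiber)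
  mem_totalSpace s hs :=
    ⟨hV.mem_base hs, by simp only [map_add, hV.proj_apply hs, hW.proj_apply hs]⟩

theorem smul (h : B.IsSmoothPath b V) (hη : ContDiffOn ℝ ∞ η (Icc 0 1)) :
    B.IsSmoothPath b fun s => η s • V s where
  contDiffOn := h.base.prodMk (hη.smul h.fiber)
  mem_totalSpace s hs := ⟨h.mem_base hs, by simp only [map_smul, h.proj_apply hs]⟩

theorem add_const_smul (hV : B.IsSmoothPath b V) (hW : B.IsSmoothPath b W) (ε : ℝ) :
    B.IsSmoothPath b fun s => V s + ε • W s :=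
  hV.add (hW.smul contDiffOn_const)

theorem covDeriv (h : B.IsSmoothPath b V) : B.IsSmoothPath b (B.covDeriv b V) where
  contDiffOn := h.base.prodMk <|
    (B.contDiffOn_proj.comp h.base fun _ hs => h.mem_base hs).clm_apply
      (contDiffOn_derivWithin_Icc zero_lt_one h.fiber)
  mem_totalSpace _ hs := ⟨h.mem_base hs, proj_proj (h.mem_base hs) _⟩

theorem covDeriv_add_const_smul (hV : B.IsSmoothPath b V) (hW : B.IsSmoothPath b W) (ε : ℝ)
    (hs : s ∈ Icc 0 1) :
    B.covDeriv b (fun s => V s + ε • W s) s = B.covDeriv b V s + ε • B.covDeriv b W s := by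
  have hV' := hV.hasDerivWithinAt_fiber hs
  have hW' := hW.hasDerivWithinAt_fiber hs
  have hderiv := (hV'.fun_add (hW'.fun_const_smul ε)).derivWithin
    (uniqueDiffOn_Icc zero_lt_one s hs)
  simp only [HilbertSubbundle.covDeriv, hderiv, map_add, map_smul]

theorem inner_covDeriv (hV : B.IsSmoothPath b V) (W : ℝ → H) (hs : s ∈ Icc 0 1) :
    inner ℝ (V s) (B.covDeriv b W s) = inner ℝ (V s) (derivWithin W (Icc 0 1) s) := by
  rw [HilbertSubbundle.covDeriv, ← inner_proj_left (hV.mem_base hs), hV.proj_apply hs]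

theorem hasDerivWithinAt_inner (hV : B.IsSmoothPath b V) (hW : B.IsSmoothPath b W)
    (hs : s ∈ Icc 0 1) :
    HasDerivWithinAt (fun s => inner ℝ (V s) (W s))
      (inner ℝ (V s) (B.covDeriv b W s) + inner ℝ (B.covDeriv b V s) (W s)) (Icc 0 1) s := by
  have hV' := hV.hasDerivWithinAt_fiber hs
  have hW' := hW.hasDerivWithinAt_fiber hs
  rw [hV.inner_covDeriv W hs, real_inner_comm (W s), hW.inner_covDeriv V hs,
    real_inner_comm _ (W s)]
  exact hV'.inner ℝ hW'

theorem integral_inner_covDeriv (hV : B.IsSmoothPath b V) (hW : B.IsSmoothPath b W)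
    (hW₀ : W 0 = 0) (hW₁ : W 1 = 0) :
    ∫ s in (0 : ℝ)..1, inner ℝ (V s) (B.covDeriv b W s) =
      -∫ s in (0 : ℝ)..1, inner ℝ (B.covDeriv b V s) (W s) := by
  have hVW : ContDiffOn ℝ ∞ (fun s => inner ℝ (V s) (W s)) (Icc 0 1) :=
    hV.fiber.inner ℝ hW.fiber
  have hint {X Y : ℝ → H} (hX : B.IsSmoothPath b X) (hY : B.IsSmoothPath b Y) :
      IntervalIntegrable (fun s => inner ℝ (X s) (Y s)) volume 0 1 :=
    (hX.fiber.inner ℝ hY.fiber).continuousOn.intervalIntegrable_of_Icc zero_le_one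
  rw [eq_neg_iff_add_eq_zero, ← intervalIntegral.integral_add (hint hV hW.covDeriv)
    (hint hV.covDeriv hW)]
  calc ∫ s in (0 : ℝ)..1, (inner ℝ (V s) (B.covDeriv b W s) + inner ℝ (B.covDeriv b V s) (W s))
      = ∫ s in (0 : ℝ)..1, derivWithin (fun s => inner ℝ (V s) (W s)) (Icc 0 1) s := by
        refine intervalIntegral.integral_congr fun s hs => ?_
        rw [uIcc_of_le zero_le_one] at hs
        exact ((hV.hasDerivWithinAt_inner hW hs).derivWithin
          (uniqueDiffOn_Icc zero_lt_one s hs)).symm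
    _ = inner ℝ (V 1) (W 1) - inner ℝ (V 0) (W 0) :=
        intervalIntegral.integral_derivWithin_Icc_of_contDiffOn_Icc (hVW.of_le (by simp))
          zero_le_one
    _ = 0 := by simp [hW₀, hW₁]

theorem contDiffOn_energyDensity (h : B.IsSmoothPath b q) :
    ContDiffOn ℝ ∞ (B.energyDensity b q) (Icc 0 1) :=
  ((contDiffOn_derivWithin_Icc zero_lt_one h.base).norm_sq ℝ).add (h.covDeriv.fiber.norm_sq ℝ)

theorem isVariation_add_smul (hq : B.IsSmoothPath b q) (hW : B.IsSmoothPath b W)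
    (hW₀ : W 0 = 0) (hW₁ : W 1 = 0) :
    B.IsVariation b q 1 (fun _ => b) fun ε s => q s + ε • W s where
  pos := one_pos
  contDiffOn := by
    have hsnd : MapsTo Prod.snd (Ioo (-1 : ℝ) 1 ×ˢ Icc (0 : ℝ) 1) (Icc 0 1) := fun _ hx => hx.2
    have hb := hq.base.comp contDiffOn_snd hsnd
    have hq := hq.fiber.comp contDiffOn_snd hsnd
    have hW := hW.fiber.comp contDiffOn_snd hsnd
    exact hb.prodMk (hq.add (contDiffOn_fst.smul hW))
  mem_totalSpace ε _ := (hq.add_const_smul hW ε).mem_totalSpace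
  center s _ := by simp
  left ε _ := by simp [hW₀]
  right ε _ := by simp [hW₁]

theorem hasDerivAt_energy_add_smul (hq : B.IsSmoothPath b q) (hW : B.IsSmoothPath b W) :
    HasDerivAt (fun ε : ℝ => B.energy b fun s => q s + ε • W s)
      (∫ s in (0 : ℝ)..1, inner ℝ (B.covDeriv b q s) (B.covDeriv b W s)) 0 := by
  let F' (ε s : ℝ) : ℝ :=
    2 * inner ℝ (B.covDeriv b q s + ε • B.covDeriv b W s) (B.covDeriv b W s)
  have hderiv : HasDerivAt
      (fun ε : ℝ => ∫ s in (0 : ℝ)..1, B.energyDensity b (fun s => q s + ε • W s) s)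
      (∫ s in (0 : ℝ)..1, F' 0 s) 0 := by
    refine hasDerivAt_intervalIntegral_of_continuousOn Filter.univ_mem ?_ ?_ ?_
    all_goals rw [uIcc_of_le zero_le_one]
    · exact fun ε _ => (hq.add_const_smul hW ε).contDiffOn_energyDensity.continuousOn
    · have hsnd : MapsTo Prod.snd ((univ : Set ℝ) ×ˢ Icc (0 : ℝ) 1) (Icc 0 1) := fun _ hx => hx.2
      have hq' := hq.covDeriv.fiber.continuousOn.comp continuousOn_snd hsnd
      have hW' := hW.covDeriv.fiber.continuousOn.comp continuousOn_snd hsnd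
      exact ((hq'.add (continuousOn_fst.smul hW')).inner hW').const_smul (2 : ℝ)
    · intro ε _ s hs
      have hline : HasDerivAt (fun ε : ℝ => B.covDeriv b q s + ε • B.covDeriv b W s)
          (B.covDeriv b W s) ε := by
        simpa using ((hasDerivAt_id ε).smul_const (B.covDeriv b W s)).const_add (B.covDeriv b q s)
      simp only [energyDensity, hq.covDeriv_add_const_smul hW _ hs]
      exact hline.norm_sq.const_add _
  exact (hderiv.const_mul (1 / 2)).congr_deriv (by simp [F'])

theorem isVariation_reparam (h : B.IsSmoothPath b q) (hη : ContDiffOn ℝ ∞ η (Icc 0 1))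
    (hη₀ : η 0 = 0) (hη₁ : η 1 = 0) {δ : ℝ} (hδ : 0 < δ)
    (hmaps : ∀ ε ∈ Ioo (-δ) δ, MapsTo (fun s => s + ε * η s) (Icc 0 1) (Icc 0 1)) :
    B.IsVariation b q δ (fun ε s => b (s + ε * η s)) fun ε s => q (s + ε * η s) where
  pos := hδ
  contDiffOn := by
    have hη' : ContDiffOn ℝ ∞ (fun x : ℝ × ℝ => η x.2) (Ioo (-δ) δ ×ˢ Icc 0 1) :=
      hη.comp contDiffOn_snd fun _ hx => hx.2
    exact h.contDiffOn.comp (contDiffOn_snd.add (contDiffOn_fst.mul hη'))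
      fun x hx => hmaps x.1 hx.1 hx.2
  mem_totalSpace ε hε s hs := h.mem_totalSpace _ (hmaps ε hε hs)
  center s _ := by simp
  left ε _ := by simp [hη₀]
  right ε _ := by simp [hη₁]

theorem energyDensity_comp (h : B.IsSmoothPath b q) {φ : ℝ → ℝ} {φ' : ℝ}
    (hφ : HasDerivWithinAt φ φ' (Icc 0 1) s) (hmaps : MapsTo φ (Icc 0 1) (Icc 0 1))
    (hs : s ∈ Icc 0 1) :
    B.energyDensity (b ∘ φ) (q ∘ φ) s =
      φ' ^ 2 * B.energyDensity b q (φ s) := by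
  have hs' := uniqueDiffOn_Icc zero_lt_one s hs
  simp only [energyDensity, HilbertSubbundle.covDeriv,
    ((h.hasDerivWithinAt_base (hmaps hs)).scomp s hφ hmaps).derivWithin hs',
    ((h.hasDerivWithinAt_fiber (hmaps hs)).scomp s hφ hmaps).derivWithin hs',
    Function.comp_apply, map_smul, norm_smul, Real.norm_eq_abs, mul_pow, sq_abs, mul_add]

end IsSmoothPath

namespace IsGeodesic

theorem integral_inner_covDeriv_eq_zero (h : B.IsGeodesic b q) (hW : B.IsSmoothPath b W)
    (hW₀ : W 0 = 0) (hW₁ : W 1 = 0) :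
    ∫ s in (0 : ℝ)..1, inner ℝ (B.covDeriv b q s) (B.covDeriv b W s) = 0 :=
  (h.hasDerivAt_energy_add_smul hW).unique
    (h.critical _ _ _ (h.isVariation_add_smul hW hW₀ hW₁))

theorem covDeriv_covDeriv_eq_zero (h : B.IsGeodesic b q) (hs : s ∈ Icc 0 1) :
    B.covDeriv b (B.covDeriv b q) s = 0 := by
  set A := B.covDeriv b (B.covDeriv b q)
  have hA : B.IsSmoothPath b A := h.covDeriv.covDeriv
  let W (s : ℝ) : H := (s * (1 - s)) • A s
  have hW : B.IsSmoothPath b W := hA.smul (by fun_prop)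
  have hW₀ : W 0 = 0 := by simp [W]
  have hW₁ : W 1 = 0 := by simp [W]
  have hint : ∫ s in (0 : ℝ)..1, inner ℝ (A s) (W s) = 0 := by
    rw [← neg_eq_zero, ← h.covDeriv.integral_inner_covDeriv hW hW₀ hW₁,
      h.integral_inner_covDeriv_eq_zero hW hW₀ hW₁]
  simp only [W, real_inner_smul_right, real_inner_self_eq_norm_sq] at hint
  exact eqOn_zero_of_intervalIntegral_mul_norm_sq_eq_zero zero_lt_one (by fun_prop)
    (fun s hs => mul_pos hs.1 (sub_pos.2 hs.2)) hA.fiber.continuousOn hint hs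

theorem integral_mul_derivWithin_energyDensity_eq_zero (h : B.IsGeodesic b q)
    (hη : ContDiffOn ℝ ∞ η (Icc 0 1)) (hη₀ : η 0 = 0) (hη₁ : η 1 = 0) {δ : ℝ} (hδ : 0 < δ)
    (hmaps : ∀ ε ∈ Ioo (-δ) δ, MapsTo (fun s => s + ε * η s) (Icc 0 1) (Icc 0 1)) :
    ∫ s in (0 : ℝ)..1, η s * derivWithin (B.energyDensity b q) (Icc 0 1) s = 0 := by
  set e := B.energyDensity b q
  have he : ContDiffOn ℝ ∞ e (Icc 0 1) := h.contDiffOn_energyDensity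
  have hη' (s : ℝ) (hs : s ∈ Icc (0 : ℝ) 1) :
      HasDerivWithinAt η (derivWithin η (Icc 0 1) s) (Icc 0 1) s :=
    (hη.differentiableOn (by simp) s hs).hasDerivWithinAt
  have h₀ : (0 : ℝ) ∈ Ioo (-δ) δ := by simp [hδ]
  have henergy (ε : ℝ) (hε : ε ∈ Ioo (-δ) δ) :
      B.energy (fun s => b (s + ε * η s)) (fun s => q (s + ε * η s)) = 1 / 2 *
        ∫ s in (0 : ℝ)..1, (1 + ε * derivWithin η (Icc 0 1) s) ^ 2 • e (s + ε * η s) := by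
    refine congrArg _ (intervalIntegral.integral_congr fun s hs => ?_)
    rw [uIcc_of_le zero_le_one] at hs
    exact h.energyDensity_comp ((hasDerivWithinAt_id s _).add ((hη' s hs).const_mul ε))
      (hmaps ε hε) hs
  have hfirst := (hasDerivAt_intervalIntegral_reparam zero_le_one isOpen_Ioo h₀ hmaps
    (fun s hs => (he.differentiableOn (by simp) s hs).hasDerivWithinAt)
    (contDiffOn_derivWithin_Icc zero_lt_one he).continuousOn hη'
    (contDiffOn_derivWithin_Icc zero_lt_one hη).continuousOn hη₀ hη₁).const_mul (1 / 2)
  have hcrit := h.critical _ _ _ (h.isVariation_reparam hη hη₀ hη₁ hδ hmaps)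
  have := hfirst.unique <| hcrit.congr_of_eventuallyEq <|
    Filter.eventually_of_mem (isOpen_Ioo.mem_nhds h₀) fun ε hε => (henergy ε hε).symm
  simpa using this

theorem energyDensity_eq (h : B.IsGeodesic b q) (hs : s ∈ Icc 0 1) :
    B.energyDensity b q s = B.energyDensity b q 0 := by
  set e := B.energyDensity b q
  have he : ContDiffOn ℝ ∞ e (Icc 0 1) := h.contDiffOn_energyDensity
  have he' : ContDiffOn ℝ ∞ (derivWithin e (Icc 0 1)) (Icc 0 1) :=
    contDiffOn_derivWithin_Icc zero_lt_one he
  obtain ⟨δ, hδ, hmaps⟩ := exists_mapsTo_reparam he'.continuousOn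
  have hint := h.integral_mul_derivWithin_energyDensity_eq_zero (by fun_prop) (by simp) (by simp)
    hδ hmaps
  have hzero : EqOn (derivWithin e (Icc 0 1)) 0 (Icc 0 1) :=
    eqOn_zero_of_intervalIntegral_mul_norm_sq_eq_zero zero_lt_one (w := fun s => s * (1 - s))
      (by fun_prop) (fun s hs => mul_pos hs.1 (sub_pos.2 hs.2)) he'.continuousOn
      (by simpa only [Real.norm_eq_abs, sq, abs_mul_abs_self, mul_assoc] using hint)
  exact constant_of_derivWithin_zero (he.differentiableOn (by simp))
    (fun s hs => hzero (Ico_subset_Icc_self hs)) s hs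

theorem norm_covDeriv_sq_eq (h : B.IsGeodesic b q) (hs : s ∈ Icc 0 1) :
    ‖B.covDeriv b q s‖ ^ 2 = ‖B.covDeriv b q 0‖ ^ 2 := by
  have hderiv (s : ℝ) (hs : s ∈ Icc (0 : ℝ) 1) :
      HasDerivWithinAt (fun s => ‖B.covDeriv b q s‖ ^ 2) 0 (Icc 0 1) s := by
    simpa [h.covDeriv_covDeriv_eq_zero hs] using h.covDeriv.hasDerivWithinAt_inner h.covDeriv hs
  exact constant_of_derivWithin_zero (fun s hs => (hderiv s hs).differentiableWithinAt)
    (fun s hs => (hderiv s (Ico_subset_Icc_self hs)).derivWithin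
      (uniqueDiffOn_Icc zero_lt_one s (Ico_subset_Icc_self hs))) s hs

theorem norm_derivWithin_eq (h : B.IsGeodesic b q) (hs : s ∈ Icc 0 1) :
    ‖derivWithin b (Icc 0 1) s‖ = ‖derivWithin b (Icc 0 1) 0‖ := by
  have henergy := h.energyDensity_eq hs
  simp only [energyDensity, h.norm_covDeriv_sq_eq hs, add_left_inj] at henergy
  exact (sq_eq_sq₀ (norm_nonneg _) (norm_nonneg _)).1 henergy

end IsGeodesic

end HilbertSubbundle

section CompLpL

open ContinuousLinearMap

open scoped ENNReal

variable {α 𝕜 E F G : Type*} [MeasurableSpace α] {μ : Measure α} {p : ℝ≥0∞} [Fact (1 ≤ p)]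

theorem compLpL_comp_apply [NontriviallyNormedField 𝕜] [NormedAddCommGroup E] [NormedSpace 𝕜 E]
    [NormedAddCommGroup F] [NormedSpace 𝕜 F] [NormedAddCommGroup G] [NormedSpace 𝕜 G]
    (S : F →L[𝕜] G) (T : E →L[𝕜] F) (f : Lp E p μ) :
    (S ∘L T).compLpL p μ f = S.compLpL p μ (T.compLpL p μ f) := by
  apply Lp.ext
  filter_upwards [(S ∘L T).coeFn_compLpL f, S.coeFn_compLpL (T.compLpL p μ f),
    T.coeFn_compLpL f] with t hST hS hT
  rw [hST, hS, hT, comp_apply]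

theorem compLpL_id_apply [NontriviallyNormedField 𝕜] [NormedAddCommGroup E] [NormedSpace 𝕜 E]
    (f : Lp E p μ) : (ContinuousLinearMap.id 𝕜 E).compLpL p μ f = f :=
  Lp.ext ((ContinuousLinearMap.id 𝕜 E).coeFn_compLpL f)

theorem isSymmetricProjection_compLpL [RCLike 𝕜] [NormedAddCommGroup E] [InnerProductSpace 𝕜 E]
    {T : E →L[𝕜] E} (hT : T.toLinearMap.IsSymmetricProjection) :
    (T.compLpL 2 μ).toLinearMap.IsSymmetricProjection where
  isIdempotentElem := LinearMap.ext fun f => by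
    have hTT : T ∘L T = T := ContinuousLinearMap.ext fun v =>
      DFunLike.congr_fun hT.isIdempotentElem.eq v
    exact (compLpL_comp_apply T T f).symm.trans (by rw [hTT]; rfl)
  isSymmetric f g := by
    simp only [L2.inner_def, coe_coe]
    refine integral_congr_ae ?_
    filter_upwards [T.coeFn_compLpL f, T.coeFn_compLpL g] with t hf hg
    rw [hf, hg]
    exact hT.isSymmetric (f t) (g t)

theorem contDiff_compLpL [NontriviallyNormedField 𝕜] [NormedAddCommGroup E] [NormedSpace 𝕜 E]
    [NormedAddCommGroup F] [NormedSpace 𝕜 F] {n : WithTop ℕ∞} :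
    ContDiff 𝕜 n fun T : E →L[𝕜] F => T.compLpL p μ :=
  (compLpL₂ p μ (ContinuousLinearMap.id 𝕜 (E →L[𝕜] F))).contDiff

end CompLpL

section SphereL2Bundle

variable {E : Type*} [NormedAddCommGroup E] [InnerProductSpace ℝ E]

theorem starProjection_orthogonal_span_singleton {p : E} (hp : ‖p‖ = 1) :
    (ℝ ∙ p)ᗮ.starProjection = ContinuousLinearMap.id ℝ E - InnerProductSpace.rankOne ℝ p p := by
  ext v
  simp [Submodule.starProjection_orthogonal, Submodule.starProjection_unit_singleton ℝ hp]

theorem contDiffOn_starProjection_orthogonal_span_singleton {n : WithTop ℕ∞} :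
    ContDiffOn ℝ n (fun p : E => (ℝ ∙ p)ᗮ.starProjection) (Metric.sphere 0 1) := by
  have hrankOne : ContDiff ℝ n fun p : E => InnerProductSpace.rankOne ℝ p p :=
    ((innerSL ℝ).contDiff).smulRight contDiff_id
  exact (contDiff_const.sub hrankOne).contDiffOn.congr fun p hp =>
    starProjection_orthogonal_span_singleton (mem_sphere_zero_iff_norm.1 hp)

/-- The bundle over the unit sphere of `E` whose fibre at `p` consists of the `L²` functions with
values in the tangent space `p^⊥`, as a subbundle of the trivial bundle with fibre `L²(μ, E)`. -/
noncomputable def sphereL2Bundle (E : Type*) [NormedAddCommGroup E] [InnerProductSpace ℝ E]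
    {α : Type*} [MeasurableSpace α] (μ : Measure α) : HilbertSubbundle E (Lp E 2 μ) where
  base := Metric.sphere 0 1
  proj p := (ℝ ∙ p)ᗮ.starProjection.compLpL 2 μ
  contDiffOn_proj := contDiff_compLpL.comp_contDiffOn
    contDiffOn_starProjection_orthogonal_span_singleton
  isSymmetricProjection_proj _ _ :=
    isSymmetricProjection_compLpL (Submodule.isSymmetricProjection_starProjection _)

theorem derivWithin_mem_orthogonal_of_mem_sphere {b : ℝ → E} {I : Set ℝ} {s : ℝ}
    (hb : ∀ r ∈ I, b r ∈ Metric.sphere (0 : E) 1) (hd : DifferentiableWithinAt ℝ b I s)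
    (hI : UniqueDiffWithinAt ℝ I s) (hs : s ∈ I) : derivWithin b I s ∈ (ℝ ∙ b s)ᗮ := by
  have hconst : HasDerivWithinAt (fun r => ‖b r‖ ^ 2) 0 I s :=
    (hasDerivWithinAt_const s I (1 : ℝ)).congr (fun r hr => by simp_all) (by simp_all)
  have := hI.eq_deriv _ hd.hasDerivWithinAt.norm_sq hconst
  rw [Submodule.mem_orthogonal_singleton_iff_inner_right]
  linarith

end SphereL2Bundle

namespace SphereBundle

/-- The bundle `ℂ` inside the trivial bundle over `ℝ³` with fibre `L²([0,1], ℝ³)`. -/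
noncomputable abbrev ambientBundle : HilbertSubbundle E3 AmbientL2 :=
  sphereL2Bundle E3 unitMeasure

theorem fiberIncl_fiberProj (p : S2) (f : AmbientL2) :
    fiberIncl p (fiberProj p f) = ambientBundle.proj p f :=
  (compLpL_comp_apply _ _ f).symm

theorem fiberProj_fiberIncl (p : S2) (v : Fiber p) : fiberProj p (fiberIncl p v) = v := by
  have hcomp : (TangentPlane p).orthogonalProjectionOnto ∘L (TangentPlane p).subtypeL =
      ContinuousLinearMap.id ℝ _ := by
    ext v
    simp
  rw [fiberProj, fiberIncl, ← compLpL_comp_apply, hcomp, compLpL_id_apply]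

theorem fiberIncl_injective (p : S2) : Function.Injective (fiberIncl p) :=
  Function.LeftInverse.injective (fiberProj_fiberIncl p)

theorem fiberIncl_covDeriv (β : ℝ → S2) (V : (s : ℝ) → Fiber (β s)) (s : ℝ) :
    fiberIncl (β s) (covDeriv β V s) =
      ambientBundle.covDeriv (fun s => β s) (fun s => fiberIncl (β s) (V s)) s :=
  fiberIncl_fiberProj _ _

theorem covDeriv_covDeriv_eq_zero_iff {β : ℝ → S2} {V : (s : ℝ) → Fiber (β s)} {s : ℝ} :
    covDeriv β (covDeriv β V) s = 0 ↔
      ambientBundle.covDeriv (fun s => β s)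
        (ambientBundle.covDeriv (fun s => β s) fun s => fiberIncl (β s) (V s)) s = 0 := by
  rw [← map_eq_zero_iff _ (fiberIncl_injective (β s)), fiberIncl_covDeriv]
  simp only [fiberIncl_covDeriv]

theorem integral_inner_self_fiber (p : S2) (v : Fiber p) :
    ∫ t, inner ℝ (v t) (v t) ∂unitMeasure = ‖fiberIncl p v‖ ^ 2 := by
  rw [← real_inner_self_eq_norm_sq, L2.inner_def]
  refine integral_congr_ae ?_
  filter_upwards [(TangentPlane p).subtypeL.coeFn_compLpL v] with t ht
  rw [fiberIncl, ht]
  rfl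

theorem range_ambient : range ambient = ambientBundle.totalSpace := by
  refine Subset.antisymm (range_subset_iff.2 fun ⟨p, v⟩ => ⟨p.2, ?_⟩) fun ⟨p, f⟩ ⟨hp, hf⟩ => ?_
  · exact (fiberIncl_fiberProj p _).symm.trans (congrArg _ (fiberProj_fiberIncl p v))
  · exact ⟨⟨⟨p, hp⟩, fiberProj ⟨p, hp⟩ f⟩,
      Prod.ext rfl ((fiberIncl_fiberProj ⟨p, hp⟩ f).trans hf)⟩

theorem ambient_injective : Function.Injective ambient := by
  rintro ⟨p, v⟩ ⟨p', v'⟩ h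
  obtain rfl : p = p' := Subtype.ext (congrArg Prod.fst h)
  exact congrArg _ (fiberIncl_injective p (congrArg Prod.snd h))

theorem metricC_velocity {γ : ℝ → BundleC} {s : ℝ}
    (hγ : DifferentiableWithinAt ℝ (fun s => (baseCurve γ s : E3)) (Icc 0 1) s)
    (hs : s ∈ Icc 0 1) :
    metricC (γ s) (velocity γ s) (velocity γ s) =
      ambientBundle.energyDensity (fun s => (ambient (γ s)).1)
        (fun s => (ambient (γ s)).2) s := by
  have htangent := derivWithin_mem_orthogonal_of_mem_sphere (fun r _ => (baseCurve γ r).2) hγ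
    (uniqueDiffOn_Icc zero_lt_one s hs) hs
  have hbase : (baseVelocity (baseCurve γ) s : E3) =
      derivWithin (fun r => (baseCurve γ r : E3)) (Icc 0 1) s :=
    Submodule.starProjection_eq_self_iff.2 htangent
  have hfiber : fiberIncl (γ s).1 (covDeriv (baseCurve γ) (fiberPart γ) s) =
      ambientBundle.covDeriv (fun s => (ambient (γ s)).1) (fun s => (ambient (γ s)).2) s :=
    fiberIncl_covDeriv (baseCurve γ) (fiberPart γ) s
  calc metricC (γ s) (velocity γ s) (velocity γ s)
      = ‖(baseVelocity (baseCurve γ) s : E3)‖ ^ 2 +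
          ‖fiberIncl (γ s).1 (covDeriv (baseCurve γ) (fiberPart γ) s)‖ ^ 2 := by
        rw [metricC, integral_inner_self_fiber, real_inner_self_eq_norm_sq]
        rfl
    _ = _ := by
        rw [hbase, hfiber]
        rfl

theorem IsSmoothPath.energy_eq {γ : ℝ → BundleC} (hγ : IsSmoothPath γ) :
    energy γ = ambientBundle.energy (fun s => (ambient (γ s)).1)
        (fun s => (ambient (γ s)).2) := by
  refine congrArg _ (intervalIntegral.integral_congr fun s hs => ?_)
  rw [uIcc_of_le zero_le_one] at hs
  exact metricC_velocity (hγ.fst.differentiableOn (by simp) s hs) hs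

theorem IsSmoothPath.isSmoothPath_ambient {γ : ℝ → BundleC} (hγ : IsSmoothPath γ) :
    ambientBundle.IsSmoothPath (fun s => (ambient (γ s)).1) (fun s => (ambient (γ s)).2) where
  contDiffOn := hγ
  mem_totalSpace s _ := range_ambient.le (mem_range_self (γ s))

theorem IsVariation.isSmoothPath {γ : ℝ → BundleC} {δ : ℝ} {Γ : ℝ → ℝ → BundleC}
    (h : IsVariation γ δ Γ) {ε : ℝ} (hε : ε ∈ Ioo (-δ) δ) : IsSmoothPath (Γ ε) :=
  h.smooth.comp (contDiffOn_const.prodMk contDiffOn_id) fun _ hs => ⟨hε, hs⟩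

theorem exists_isVariation_ambient_eq {γ : ℝ → BundleC} {δ : ℝ} {β : ℝ → ℝ → E3}
    {Q : ℝ → ℝ → AmbientL2} (h : ambientBundle.IsVariation (fun s => (ambient (γ s)).1)
      (fun s => (ambient (γ s)).2) δ β Q) :
    ∃ Γ, IsVariation γ δ Γ ∧
      ∀ ε ∈ Ioo (-δ) δ, ∀ s ∈ Icc (0 : ℝ) 1, ambient (Γ ε s) = (β ε s, Q ε s) := by
  have : Nonempty BundleC := ⟨γ 0⟩
  let Γ (ε s : ℝ) : BundleC := Function.invFun ambient (β ε s, Q ε s)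
  have hΓ (ε : ℝ) (hε : ε ∈ Ioo (-δ) δ) (s : ℝ) (hs : s ∈ Icc (0 : ℝ) 1) :
      ambient (Γ ε s) = (β ε s, Q ε s) :=
    Function.invFun_eq (range_ambient.ge (h.mem_totalSpace ε hε s hs))
  have h₀ : (0 : ℝ) ∈ Ioo (-δ) δ := by simp [h.pos]
  refine ⟨Γ, ?_, hΓ⟩
  exact {
    pos := h.pos
    smooth := h.contDiffOn.congr fun x hx => hΓ x.1 hx.1 x.2 hx.2
    center s hs := ambient_injective <| (hΓ 0 h₀ s hs).trans (h.center s hs)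
    left ε hε := ambient_injective <| (hΓ ε hε 0 (by simp)).trans (h.left ε hε)
    right ε hε := ambient_injective <| (hΓ ε hε 1 (by simp)).trans (h.right ε hε) }

theorem IsGeodesic.isGeodesic_ambient {γ : ℝ → BundleC} (hγ : IsGeodesic γ) :
    ambientBundle.IsGeodesic (fun s => (ambient (γ s)).1) (fun s => (ambient (γ s)).2) where
  toIsSmoothPath := hγ.smooth.isSmoothPath_ambient
  critical δ β Q hvar := by
    obtain ⟨Γ, hΓvar, hΓ⟩ := exists_isVariation_ambient_eq hvar
    refine (hγ.critical δ Γ hΓvar).congr_of_eventuallyEq <|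
      Filter.eventually_of_mem (Ioo_mem_nhds (neg_lt_zero.2 hvar.pos) hvar.pos) fun ε hε => ?_
    refine .trans ?_ (hΓvar.isSmoothPath hε).energy_eq.symm
    exact HilbertSubbundle.energy_congr (fun s hs => (congrArg Prod.fst (hΓ ε hε s hs)).symm)
      fun s hs => (congrArg Prod.snd (hΓ ε hε s hs)).symm

end SphereBundle

theorem mainTheorem2_general {E H : Type*} [NormedAddCommGroup E] [InnerProductSpace ℝ E]
    [NormedAddCommGroup H] [InnerProductSpace ℝ H] (B : HilbertSubbundle E H) {b : ℝ → E}
    {q : ℝ → H} (h : B.IsGeodesic b q) :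
    (∃ c : ℝ, ∀ s ∈ Icc (0 : ℝ) 1, ‖derivWithin b (Icc 0 1) s‖ = c) ∧
      ∀ s ∈ Icc (0 : ℝ) 1, B.covDeriv b (B.covDeriv b q) s = 0 :=
  ⟨⟨_, fun _ => h.norm_derivWithin_eq⟩, fun _ => h.covDeriv_covDeriv_eq_zero⟩

theorem mainTheorem2 (γ : ℝ → SphereBundle.BundleC) (hγ : SphereBundle.IsGeodesic γ) :
    (∃ c : ℝ, ∀ s ∈ Set.Icc (0 : ℝ) 1,
      ‖derivWithin (fun r => (SphereBundle.baseCurve γ r : SphereBundle.E3)) (Set.Icc 0 1) s‖ = c) ∧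
    (∀ s ∈ Set.Icc (0 : ℝ) 1,
      SphereBundle.covDeriv (SphereBundle.baseCurve γ)
        (SphereBundle.covDeriv (SphereBundle.baseCurve γ) (SphereBundle.fiberPart γ)) s = 0) := by
  obtain ⟨hspeed, hlinear⟩ := mainTheorem2_general _ hγ.isGeodesic_ambient
  exact ⟨hspeed, fun s hs => SphereBundle.covDeriv_covDeriv_eq_zero_iff.2 (hlinear s hs)⟩
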